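/- Fix $\beta>0$. On a probability space, let $(Z^{(n)}_k)_{n\ge 1,\,1\le k\le n}$ be complex random variables and, for each $n\ge1$, let $\gamma^{(n)}_1,\dots,\gamma^{(n)}_n$ be i.i.d. real random variables with the Gamma distribution of parameter $\beta/2$, that is, with density $\Gamma(\beta/2)^{-1}t^{\beta/2-1}e^{-t}$ on $(0,\infty)$, such that the family $(\gamma^{(n)}_k)_{1\le k\le n}$ is independent of the family $(Z^{(n)}_k)_{1\le k\le n}$. (No other condition is put on the joint law of the points, and none on the dependence between different values of $n$.) Let $\mu_n=\frac1n\sum_{k=1}^n\delta_{Z^{(n)}_k}$ and, for $n\ge2$, let $\nu_n$ be the empirical measure (normalized to total mass $1$) of the complex zeros, counted with multiplicity, of the randomized derivative $$Q_n(z)=\sum_{k=1}^n\gamma^{(n)}_k\prod_{1\le j\le n,\ j\ne k}\bigl(z-Z^{(n)}_j\bigr),$$ which almost surely has degree $n-1$. If, almost surely, $(\mu_n)_{n\ge1}$ converges weakly to a deterministic finite Borel measure $\mu$ on $\mathbb C$ (which is then necessarily a probability measure), then, almost surely, $(\nu_n)_{n\ge2}$ converges weakly to $\mu$. -/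

import Mathlib

open MeasureTheory ProbabilityTheory Filter Topology Polynomial

noncomputable section

/-- The empirical measure `(1 / |s|) ∑_{z ∈ s} δ_z` of a finite family `s` of complex numbers, each
counted with its multiplicity (it is the zero measure if `s` is empty). The type
`FiniteMeasure ℂ` carries the topology of weak convergence of measures. -/
def empiricalMeasure (s : Multiset ℂ) : FiniteMeasure ℂ :=
  ⟨(s.card : ENNReal)⁻¹ • (s.map fun z => Measure.dirac z).sum, by
    have h : ∀ t : Multiset ℂ,
        (t.map fun z => (Measure.dirac z : Measure ℂ)).sum Set.univ = (t.card : ENNReal) := by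
      intro t
      induction t using Multiset.induction_on with
      | empty => simp
      | cons a t ih => simp [ih, add_comm]
    refine ⟨?_⟩
    rw [Measure.smul_apply, h, smul_eq_mul]
    exact lt_of_le_of_lt (ENNReal.inv_mul_le_one _) ENNReal.one_lt_top⟩

/-- The randomized derivative `Q(z) = ∑_k c_k ∏_{j ≠ k} (z - z_j)`, with weights `c_k`, of the
polynomial `∏_j (z - z_j)`. -/
def weightedDerivative {n : ℕ} (z : Fin n → ℂ) (c : Fin n → ℝ) : ℂ[X] :=
  ∑ k : Fin n, C (c k : ℂ) * ∏ j ∈ Finset.univ.erase k, (X - C (z j))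

/-- The empirical measure `(1 / n) ∑_k δ_{z_k}` of the points `z_1, …, z_n`. -/
def pointMeasure {n : ℕ} (z : Fin n → ℂ) : FiniteMeasure ℂ :=
  empiricalMeasure (Finset.univ.val.map z)

/-- The empirical measure of the complex zeros, counted with multiplicity, of the randomized
derivative with points `z_k` and weights `c_k`. -/
def zeroMeasure {n : ℕ} (z : Fin n → ℂ) (c : Fin n → ℝ) : FiniteMeasure ℂ :=
  empiricalMeasure (weightedDerivative z c).roots

end

/-! Off the points, `Q_n = P_n S_n` with `P_n(w) = ∏ (w - Z_k)` and `S_n(w) = ∑ γ_k / (w - Z_k)`.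
Jensen's formula turns the average of `log |S_n|` over a circle about `a` into the sum of `log
max(r, |· - a|)` over the zeros, minus the same sum over the points, plus a constant that does not
depend on the radius. Subtracting two radii compares zeros and points on the test function
`logAnnulus` (`sum_roots_logAnnulus`), so it suffices that the circle averages of `log |S_n|` are
`o(n)`. Upper bound: by Borel–Cantelli in the radius, almost every circle stays at distance `exp(-ε
n)` from the points, while the sum of the weights is at most `exp(ε n)`. Lower bound: `S_n` is
affine in each single weight, and a Gamma variable has small negative moments bounded uniformly over
the base point. Using a point that stays in a fixed disc, this bounds the expectation of the
integral of `|S_n|^(-α)` over the circle, uniformly in `n`; Borel–Cantelli and concavity of the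
logarithm finish. Each `n` enters only through summable probabilities, so no relation between
different `n` matters. Only lower bounds on ball masses are needed, because the zero measures have
mass at most 1. -/

/-! ### Weak convergence from lower bounds on balls -/

/-- If the liminf of the mass that `ν n` gives to every closed ball is at least the `μ`-mass of the
open ball, then the liminf of the mass of every open set is at least its `μ`-mass. -/
theorem eventually_measureReal_isOpen_of_ball {ν : ℕ → Measure ℂ} [∀ n, IsFiniteMeasure (ν n)]
    {μ : Measure ℂ} [IsFiniteMeasure μ]
    (h : ∀ x : ℂ, ∀ r : ℝ, 0 < r → ∀ ε : ℝ, 0 < ε → ∀ᶠ n in atTop,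
      μ.real (Metric.ball x r) - ε ≤ (ν n).real (Metric.closedBall x r))
    {U : Set ℂ} (hU : IsOpen U) {ε : ℝ} (hε : 0 < ε) :
    ∀ᶠ n in atTop, μ.real U - ε ≤ (ν n).real U := by
  set f : ℂ → Set ℝ := fun x => {r | 0 < r ∧ Metric.closedBall x r ⊆ U ∧
    μ (Metric.sphere x r) = 0}
  have hf' : ∀ x ∈ U, ∀ δ > 0, (f x ∩ Set.Ioo 0 δ).Nonempty := by
    intro x hx δ hδ
    obtain ⟨ρ, hρ, hρU⟩ := Metric.nhds_basis_closedBall.mem_iff.1 (hU.mem_nhds hx)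
    -- Concentric spheres are disjoint, so a finite measure charges only countably many of them.
    have hc : {r : ℝ | 0 < μ (Metric.sphere x r)}.Countable := by
      refine Measure.countable_meas_pos_of_disjoint_iUnion (μ := μ)
        (fun r => Metric.isClosed_sphere.measurableSet) ?_
      intro r s hrs
      refine Set.disjoint_left.2 fun y hy hy' => hrs ?_
      rw [← Metric.mem_sphere.1 hy, ← Metric.mem_sphere.1 hy']
    have hne : (Set.Ioo 0 (min δ ρ) \ {r : ℝ | 0 < μ (Metric.sphere x r)}).Nonempty := by
      rw [Set.sdiff_nonempty]
      intro hsub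
      exact (Cardinal.Real.Ioo_countable_iff.1 (hc.mono hsub)).not_gt (lt_min hδ hρ)
    obtain ⟨r, ⟨hr0, hr1⟩, hr2⟩ := hne
    refine ⟨r, ⟨hr0, ?_, ?_⟩, hr0, hr1.trans_le (min_le_left _ _)⟩
    · exact (Metric.closedBall_subset_closedBall (hr1.le.trans (min_le_right _ _))).trans hρU
    · simpa using hr2
  obtain ⟨t, r, htc, -, hr, hcov, hdisj⟩ := Besicovitch.exists_disjoint_closedBall_covering_ae μ f
    U hf' (fun _ => 1) (fun _ _ => one_pos)
  have hmeas : ∀ x : ℂ, MeasurableSet (Metric.closedBall x (r x)) :=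
    fun x => Metric.isClosed_closedBall.measurableSet
  have hle : μ U ≤ ∑' x : t, μ (Metric.closedBall (x : ℂ) (r x)) := by
    rw [← measure_biUnion htc hdisj fun x _ => hmeas x]
    calc μ U ≤ μ (U \ (⋃ x ∈ t, Metric.closedBall x (r x)) ∪ ⋃ x ∈ t, Metric.closedBall x (r x)) :=
          measure_mono (by rw [Set.sdiff_union_self]; exact Set.subset_union_left)
      _ ≤ _ := (measure_union_le _ _).trans (by rw [hcov, zero_add])
  obtain ⟨F, hF⟩ : ∃ F : Finset t,
      μ.real U - ε / 2 ≤ ∑ x ∈ F, μ.real (Metric.closedBall (x : ℂ) (r x)) := by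
    have hfin : ∑' x : t, μ (Metric.closedBall (x : ℂ) (r x)) ≠ ⊤ := by
      rw [← measure_biUnion htc hdisj fun x _ => hmeas x]
      exact measure_ne_top _ _
    have ht := (ENNReal.tendsto_toReal hfin).comp
      (ENNReal.summable (f := fun x : t => μ (Metric.closedBall (x : ℂ) (r x)))).hasSum
    have hlt : μ.real U - ε / 2 < (∑' x : t, μ (Metric.closedBall (x : ℂ) (r x))).toReal :=
      (sub_lt_self _ (half_pos hε)).trans_le (ENNReal.toReal_mono hfin hle)
    obtain ⟨F, hF⟩ := ((tendsto_order.1 ht).1 _ hlt).exists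
    refine ⟨F, hF.le.trans_eq ?_⟩
    exact ENNReal.toReal_sum fun x _ => measure_ne_top _ _
  -- The errors over `F` add up to at most `ε / 2`; the `+ 1` covers an empty `F`.
  have hev : ∀ᶠ n in atTop, ∀ x ∈ F, μ.real (Metric.ball (x : ℂ) (r x)) - ε / (2 * (F.card + 1)) ≤
      (ν n).real (Metric.closedBall (x : ℂ) (r x)) := by
    rw [Filter.eventually_all_finset]
    exact fun x _ => h x (r x) (hr x x.2).1.1 _ (by positivity)
  filter_upwards [hev] with n hn
  have hball : ∀ x : t, μ.real (Metric.ball (x : ℂ) (r x)) =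
      μ.real (Metric.closedBall (x : ℂ) (r x)) := by
    intro x
    refine (measureReal_congr ?_)
    refine (ae_eq_of_subset_of_measure_ge Metric.ball_subset_closedBall ?_
      Metric.isOpen_ball.measurableSet.nullMeasurableSet (measure_ne_top _ _))
    rw [← Metric.ball_union_sphere]
    exact (measure_union_le _ _).trans (by rw [(hr x x.2).1.2.2, add_zero])
  have hsum : ∑ x ∈ F, (ν n).real (Metric.closedBall (x : ℂ) (r x)) ≤ (ν n).real U := by
    rw [← measureReal_biUnion_finset (f := fun x : t => Metric.closedBall (x : ℂ) (r x))
      (fun x _ y _ hxy => hdisj x.2 y.2 (Subtype.coe_injective.ne hxy)) fun x _ => hmeas x]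
    exact measureReal_mono (Set.iUnion₂_subset fun x _ => (hr x x.2).1.2.1)
  have hcard : (F.card : ℝ) * (ε / (2 * (F.card + 1))) ≤ ε / 2 := by
    rw [mul_div_assoc', div_le_div_iff₀ (by positivity) (by norm_num)]
    nlinarith
  have := Finset.sum_le_sum hn
  rw [Finset.sum_sub_distrib, Finset.sum_const, nsmul_eq_mul] at this
  simp only [hball] at this
  linarith

/-- Taking the whole plane as the open set forces the masses to tend to 1, so no mass escapes and
tightness needs no separate proof. The portmanteau theorem then applies to the normalized measures,
since normalizing only increases values when the mass is at most 1. -/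
theorem FiniteMeasure.tendsto_of_forall_ball {ν : ℕ → FiniteMeasure ℂ} {μ : FiniteMeasure ℂ}
    (hμ : μ.mass = 1) (hν : ∀ n, (ν n).mass ≤ 1)
    (h : ∀ x : ℂ, ∀ r : ℝ, 0 < r → ∀ ε : ℝ, 0 < ε → ∀ᶠ n in atTop,
      (μ : Measure ℂ).real (Metric.ball x r) - ε ≤
        (ν n : Measure ℂ).real (Metric.closedBall x r)) :
    Tendsto ν atTop (𝓝 μ) := by
  have hopen : ∀ U : Set ℂ, IsOpen U → ∀ ε : ℝ, 0 < ε → ∀ᶠ n in atTop,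
      (μ : Measure ℂ).real U - ε ≤ (ν n : Measure ℂ).real U :=
    fun U hU ε hε => eventually_measureReal_isOpen_of_ball h hU hε
  have hmass : Tendsto (fun n => (ν n).mass) atTop (𝓝 μ.mass) := by
    rw [hμ, ← NNReal.tendsto_coe]
    refine tendsto_order.2 ⟨fun a ha => ?_, fun a ha => Eventually.of_forall fun n =>
      lt_of_le_of_lt (by exact_mod_cast hν n) ha⟩
    have h1 := hopen Set.univ isOpen_univ ((1 - a) / 2) (by simp at ha; linarith)
    filter_upwards [h1] with n hn
    have e1 : (μ : Measure ℂ).real Set.univ = 1 := by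
      rw [FiniteMeasure.measureReal_eq_coe_coeFn]; exact_mod_cast hμ
    have e2 : (ν n : Measure ℂ).real Set.univ = ((ν n).mass : ℝ) := by
      rw [FiniteMeasure.measureReal_eq_coe_coeFn]; rfl
    rw [e1, e2] at hn
    simp only [NNReal.coe_one] at ha
    linarith
  have hne : ∀ᶠ n in atTop, ν n ≠ 0 := by
    filter_upwards [(tendsto_order.1 hmass).1 0 (by simp [hμ])] with n hn
    exact (FiniteMeasure.mass_nonzero_iff _).1 hn.ne'
  have hμ0 : μ ≠ 0 := (FiniteMeasure.mass_nonzero_iff _).1 (by simp [hμ])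
  refine FiniteMeasure.tendsto_of_tendsto_normalize_testAgainstNN_of_tendsto_mass ?_ hmass
  refine tendsto_of_forall_isOpen_le_liminf fun U hU => ?_
  have hμU : μ.normalize U = μ U := by rw [μ.normalize_eq_of_nonzero hμ0, hμ]; simp
  rw [hμU]
  refine le_of_forall_lt fun c hc => ?_
  obtain ⟨d, hcd, hd⟩ := exists_between hc
  refine hcd.trans_le (le_liminf_of_le ?_ ?_)
  · exact IsBoundedUnder.isCoboundedUnder_ge ⟨1, by simp⟩
  have hd' : (d : ℝ) < (μ : Measure ℂ).real U := by
    rw [FiniteMeasure.measureReal_eq_coe_coeFn]; exact_mod_cast hd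
  filter_upwards [hopen U hU ((μ : Measure ℂ).real U - d) (by linarith), hne] with n hn hn0
  rw [sub_sub_cancel, FiniteMeasure.measureReal_eq_coe_coeFn] at hn
  have hdn : d ≤ ν n U := by exact_mod_cast hn
  refine hdn.trans ?_
  rw [(ν n).self_eq_mass_mul_normalize U]
  exact mul_le_of_le_one_left (zero_le) (hν n)

/-! ### Jensen's formula for polynomials -/

/-- **Jensen's formula** for a single linear factor. -/
theorem circleAverage_log_norm_sub {a w : ℂ} {r : ℝ} (hr : 0 < r) :
    Real.circleAverage (fun z => Real.log ‖z - w‖) a r = Real.log (max r ‖w - a‖) := by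
  rw [circleAverage_log_norm_sub_const_eq_log_radius_add_posLog hr.ne', norm_sub_rev a w,
    Real.posLog_apply]
  rcases le_or_gt ‖w - a‖ r with h | h
  · have : Real.log (r⁻¹ * ‖w - a‖) ≤ 0 :=
      Real.log_nonpos (by positivity) (by rw [inv_mul_le_iff₀ hr]; linarith)
    rw [max_eq_left this, max_eq_left h, add_zero]
  · have hw : 0 < ‖w - a‖ := hr.trans h
    have : 0 ≤ Real.log (r⁻¹ * ‖w - a‖) :=
      Real.log_nonneg (by rw [le_inv_mul_iff₀ hr]; linarith)
    rw [max_eq_right this, max_eq_right h.le, ← Real.log_mul hr.ne' (by positivity)]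
    congr 1
    field_simp

theorem circleIntegrable_log_norm_eval (p : ℂ[X]) (a : ℂ) (r : ℝ) :
    CircleIntegrable (fun z => Real.log ‖p.eval z‖) a r :=
  MeromorphicOn.circleIntegrable_log_norm fun z _ =>
    (AnalyticOnNhd.eval_polynomial p z (Set.mem_univ z)).meromorphicAt

theorem circleAverage_log_norm_eval_mul {p q : ℂ[X]} (hp : p ≠ 0) (hq : q ≠ 0) {a : ℂ} {r : ℝ}
    (hr : 0 < r) :
    Real.circleAverage (fun z => Real.log ‖(p * q).eval z‖) a r =
      Real.circleAverage (fun z => Real.log ‖p.eval z‖) a r +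
      Real.circleAverage (fun z => Real.log ‖q.eval z‖) a r := by
  rw [← Real.circleAverage_fun_add (circleIntegrable_log_norm_eval p a r)
    (circleIntegrable_log_norm_eval q a r)]
  -- The logarithm of the product splits away from finitely many zeros, which the average ignores.
  refine Real.circleAverage_congr_codiscreteWithin ?_ hr.ne'
  have hfin : {z : ℂ | (p * q).eval z = 0}.Finite :=
    ((p * q).roots.toFinset.finite_toSet).subset fun z hz => by simpa [hp, hq] using hz
  filter_upwards [compl_finite_mem_codiscreteWithin hfin] with z hz
  simp only [Set.mem_compl_iff, Set.mem_ofPred_eq, eval_mul, mul_eq_zero, not_or] at hz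
  rw [eval_mul, norm_mul, Real.log_mul (norm_ne_zero_iff.2 hz.1) (norm_ne_zero_iff.2 hz.2)]

/-- **Jensen's formula** for a product of linear factors. -/
theorem circleAverage_log_norm_prod {a : ℂ} {r : ℝ} (hr : 0 < r) (s : Multiset ℂ) :
    Real.circleAverage (fun z => Real.log ‖(s.map fun w => X - C w).prod.eval z‖) a r =
      (s.map fun w => Real.log (max r ‖w - a‖)).sum := by
  induction s using Multiset.induction_on with
  | empty => simp [Real.circleAverage_const]
  | cons w s ih =>
    rw [Multiset.map_cons, Multiset.prod_cons, circleAverage_log_norm_eval_mul (X_sub_C_ne_zero w)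
      (monic_multiset_prod_of_monic _ _ fun w _ => monic_X_sub_C w).ne_zero hr, ih]
    simp [circleAverage_log_norm_sub hr]

/-- **Jensen's formula** for polynomials. -/
theorem circleAverage_log_norm_eval {p : ℂ[X]} (hp : p ≠ 0) {a : ℂ} {r : ℝ} (hr : 0 < r) :
    Real.circleAverage (fun z => Real.log ‖p.eval z‖) a r =
      Real.log ‖p.leadingCoeff‖ + (p.roots.map fun w => Real.log (max r ‖w - a‖)).sum := by
  have hsplit := (IsAlgClosed.splits p).eq_prod_roots
  conv_lhs => rw [hsplit]
  rw [circleAverage_log_norm_eval_mul (by simpa using hp)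
      (monic_multiset_prod_of_monic _ _ fun w _ => monic_X_sub_C w).ne_zero hr,
    circleAverage_log_norm_prod hr]
  simp [Real.circleAverage_const]

/-! ### The weighted Cauchy transform -/

/-- The weighted Cauchy transform `∑_k c_k / (w - z_k)` of the points `z_k`. -/
noncomputable def cauchySum {n : ℕ} (z : Fin n → ℂ) (c : Fin n → ℝ) (w : ℂ) : ℂ :=
  ∑ k, (c k : ℂ) * (w - z k)⁻¹

theorem eval_weightedDerivative {n : ℕ} {z : Fin n → ℂ} (c : Fin n → ℝ) {w : ℂ}
    (hw : ∀ k, w ≠ z k) :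
    (weightedDerivative z c).eval w = (∏ k, (w - z k)) * cauchySum z c w := by
  rw [weightedDerivative, eval_finsetSum, cauchySum, Finset.mul_sum]
  refine Finset.sum_congr rfl fun k _ => ?_
  rw [eval_mul, eval_C, eval_prod, ← Finset.mul_prod_erase _ _ (Finset.mem_univ k)]
  have : w - z k ≠ 0 := sub_ne_zero.2 (hw k)
  simp only [eval_sub, eval_X, eval_C]
  field_simp

theorem card_roots_weightedDerivative_le {n : ℕ} (z : Fin n → ℂ) (c : Fin n → ℝ) :
    Multiset.card (weightedDerivative z c).roots ≤ n := by
  refine (card_roots' _).trans (natDegree_sum_le_of_forall_le _ _ fun k _ => ?_)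
  refine (natDegree_C_mul_le _ _).trans ((natDegree_prod_le _ _).trans ?_)
  simp only [natDegree_X_sub_C, Finset.sum_const, smul_eq_mul, mul_one]
  exact (Finset.card_le_univ _).trans_eq (Fintype.card_fin n)

/-- **Jensen's formula** for the weighted Cauchy transform. -/
theorem circleAverage_log_norm_cauchySum {n : ℕ} {z : Fin n → ℂ} {c : Fin n → ℝ} {a : ℂ} {r : ℝ}
    (hr : 0 < r) (hz : ∀ k, ‖z k - a‖ ≠ r) (hQ : weightedDerivative z c ≠ 0) :
    Real.circleAverage (fun w => Real.log ‖cauchySum z c w‖) a r =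
      Real.log ‖(weightedDerivative z c).leadingCoeff‖ +
        ((weightedDerivative z c).roots.map fun w => Real.log (max r ‖w - a‖)).sum -
        ∑ k, Real.log (max r ‖z k - a‖) := by
  have hP := circleAverage_log_norm_prod (a := a) hr (Finset.univ.val.map z)
  rw [Multiset.map_map, Multiset.map_map] at hP
  have hPsum : (Multiset.map ((fun w => Real.log (max r ‖w - a‖)) ∘ z) Finset.univ.val).sum =
      ∑ k, Real.log (max r ‖z k - a‖) := rfl
  rw [hPsum] at hP
  rw [← circleAverage_log_norm_eval hQ hr, ← hP, ← Real.circleAverage_fun_sub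
    (circleIntegrable_log_norm_eval _ a r) (circleIntegrable_log_norm_eval _ a r)]
  refine Real.circleAverage_congr_codiscreteWithin ?_ hr.ne'
  have hfin : {w : ℂ | (weightedDerivative z c).eval w = 0}.Finite :=
    ((weightedDerivative z c).roots.toFinset.finite_toSet).subset fun w hw => by
      simpa [hQ] using hw
  filter_upwards [compl_finite_mem_codiscreteWithin hfin, self_mem_codiscreteWithin _] with w hw hwr
  have hwz : ∀ k, w ≠ z k := fun k h => hz k (by
    rw [← h, ← dist_eq_norm, Metric.mem_sphere.1 hwr, abs_of_pos hr])
  have hprod : (Multiset.map ((fun w => X - C w) ∘ z) Finset.univ.val).prod.eval w =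
      ∏ k, (w - z k) := by
    change (∏ k, (X - C (z k))).eval w = _
    simp [eval_prod]
  have hw' : (weightedDerivative z c).eval w ≠ 0 := hw
  rw [eval_weightedDerivative c hwz] at hw'
  rw [hprod, eval_weightedDerivative c hwz, norm_mul,
    Real.log_mul (norm_ne_zero_iff.2 (left_ne_zero_of_mul hw'))
      (norm_ne_zero_iff.2 (right_ne_zero_of_mul hw'))]
  ring

/-! ### Integrals against empirical measures -/

theorem integrable_multiset_sum_dirac (f : ℂ → ℝ) (s : Multiset ℂ) :
    Integrable f (s.map fun z => (Measure.dirac z : Measure ℂ)).sum := by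
  induction s using Multiset.induction_on with
  | empty => simp
  | cons a s ih =>
    rw [Multiset.map_cons, Multiset.sum_cons]
    exact (integrable_dirac (by simp)).add_measure ih

theorem integral_multiset_sum_dirac (f : ℂ → ℝ) (s : Multiset ℂ) :
    ∫ w, f w ∂(s.map fun z => (Measure.dirac z : Measure ℂ)).sum = (s.map f).sum := by
  induction s using Multiset.induction_on with
  | empty => simp
  | cons a s ih =>
    rw [Multiset.map_cons, Multiset.sum_cons, integral_add_measure (integrable_dirac (by simp))
      (integrable_multiset_sum_dirac f s), ih, integral_dirac, Multiset.map_cons,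
      Multiset.sum_cons]

theorem integral_empiricalMeasure (f : ℂ → ℝ) (s : Multiset ℂ) :
    ∫ w, f w ∂(empiricalMeasure s : Measure ℂ) = (s.card : ℝ)⁻¹ * (s.map f).sum := by
  change ∫ w, f w ∂((s.card : ENNReal)⁻¹ • (s.map fun z => (Measure.dirac z : Measure ℂ)).sum) = _
  rw [integral_smul_measure, integral_multiset_sum_dirac]
  simp

theorem mass_empiricalMeasure (s : Multiset ℂ) :
    ((empiricalMeasure s).mass : ℝ) = (s.card : ℝ)⁻¹ * s.card := by
  have h := integral_empiricalMeasure (fun _ => 1) s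
  rw [integral_const, FiniteMeasure.measureReal_eq_coe_coeFn, smul_eq_mul, mul_one,
    Multiset.map_const', Multiset.sum_replicate, nsmul_eq_mul, mul_one] at h
  exact h

theorem mass_empiricalMeasure_le_one (s : Multiset ℂ) : (empiricalMeasure s).mass ≤ 1 := by
  rw [← NNReal.coe_le_coe, mass_empiricalMeasure]
  exact inv_mul_le_one

theorem integral_pointMeasure (f : ℂ → ℝ) {n : ℕ} (z : Fin n → ℂ) :
    ∫ w, f w ∂(pointMeasure z : Measure ℂ) = (n : ℝ)⁻¹ * ∑ k, f (z k) := by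
  rw [pointMeasure, integral_empiricalMeasure, Multiset.map_map]
  simp only [Multiset.card_map, Finset.card_val, Finset.card_univ, Fintype.card_fin]
  rfl

theorem mass_eq_one_of_tendsto_pointMeasure {z : (n : ℕ) → Fin n → ℂ} {μ : FiniteMeasure ℂ}
    (hμ : Tendsto (fun n => pointMeasure (z n)) atTop (𝓝 μ)) : μ.mass = 1 := by
  refine tendsto_nhds_unique hμ.mass (tendsto_const_nhds.congr' ?_)
  filter_upwards [eventually_ge_atTop 1] with n hn
  rw [← NNReal.coe_inj, pointMeasure, mass_empiricalMeasure]
  simp [show n ≠ 0 by omega]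

/-! ### A radial test function adapted to Jensen's formula -/

/-- The radial function equal to `log (s / r)` on the ball of radius `r` about `a`, to `0` outside
the ball of radius `s`, and to `log (s / ‖w - a‖)` in between. -/
noncomputable def logAnnulus (a : ℂ) (r s : ℝ) (w : ℂ) : ℝ :=
  Real.log (max s ‖w - a‖) - Real.log (max r ‖w - a‖)

section logAnnulus

variable {a w : ℂ} {r s : ℝ}

theorem logAnnulus_nonneg (hr : 0 < r) (hrs : r ≤ s) : 0 ≤ logAnnulus a r s w :=
  sub_nonneg.2 (Real.log_le_log (lt_max_of_lt_left hr) (max_le_max_right _ hrs))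

theorem logAnnulus_eq_zero (hrs : r ≤ s) (hw : s ≤ ‖w - a‖) : logAnnulus a r s w = 0 := by
  rw [logAnnulus, max_eq_right hw, max_eq_right (hrs.trans hw), sub_self]

theorem logAnnulus_of_norm_le (hrs : r ≤ s) (hw : ‖w - a‖ ≤ r) :
    logAnnulus a r s w = Real.log s - Real.log r := by
  rw [logAnnulus, max_eq_left hw, max_eq_left (hw.trans hrs)]

theorem logAnnulus_le (hr : 0 < r) (hrs : r ≤ s) :
    logAnnulus a r s w ≤ Real.log s - Real.log r := by
  have hs : 0 < s := hr.trans_le hrs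
  rcases le_total ‖w - a‖ s with h | h
  · rw [logAnnulus, max_eq_left h]
    exact sub_le_sub_left (Real.log_le_log hr (le_max_left _ _)) _
  · rw [logAnnulus_eq_zero hrs h]
    exact sub_nonneg.2 (Real.log_le_log hr hrs)

theorem continuous_logAnnulus (hr : 0 < r) (hrs : r ≤ s) : Continuous (logAnnulus a r s) := by
  have h : ∀ t : ℝ, 0 < t → Continuous fun w : ℂ => Real.log (max t ‖w - a‖) := fun t ht =>
    (continuous_const.max (continuous_id.sub continuous_const).norm).log fun w =>
      (lt_max_of_lt_left ht).ne'
  exact (h s (hr.trans_le hrs)).sub (h r hr)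

theorem integrable_logAnnulus (hr : 0 < r) (hrs : r ≤ s) (μ : Measure ℂ) [IsFiniteMeasure μ] :
    Integrable (logAnnulus a r s) μ :=
  Integrable.of_bound (continuous_logAnnulus hr hrs).aestronglyMeasurable
    (Real.log s - Real.log r) (ae_of_all _ fun w => by
      rw [Real.norm_of_nonneg (logAnnulus_nonneg hr hrs)]; exact logAnnulus_le hr hrs)

theorem integral_logAnnulus_le (hr : 0 < r) (hrs : r ≤ s) (μ : Measure ℂ) [IsFiniteMeasure μ] :
    ∫ w, logAnnulus a r s w ∂μ ≤ (Real.log s - Real.log r) * μ.real (Metric.closedBall a s) := by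
  have hm : MeasurableSet (Metric.closedBall a s) := Metric.isClosed_closedBall.measurableSet
  calc ∫ w, logAnnulus a r s w ∂μ
      ≤ ∫ w, (Metric.closedBall a s).indicator (fun _ => Real.log s - Real.log r) w ∂μ := by
        refine integral_mono (integrable_logAnnulus hr hrs μ)
          ((integrable_const _).indicator hm) fun w => ?_
        by_cases hw : w ∈ Metric.closedBall a s
        · rw [Set.indicator_of_mem hw]; exact logAnnulus_le hr hrs
        · rw [Set.indicator_of_notMem hw, logAnnulus_eq_zero hrs]
          rw [mem_closedBall_iff_norm, not_le] at hw
          exact hw.le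
    _ = _ := by rw [integral_indicator_const _ hm, smul_eq_mul, mul_comm]

theorem le_integral_logAnnulus (hr : 0 < r) (hrs : r ≤ s) (μ : Measure ℂ) [IsFiniteMeasure μ] :
    (Real.log s - Real.log r) * μ.real (Metric.ball a r) ≤ ∫ w, logAnnulus a r s w ∂μ := by
  have hm : MeasurableSet (Metric.ball a r) := Metric.isOpen_ball.measurableSet
  calc _ = ∫ w, (Metric.ball a r).indicator (fun _ => Real.log s - Real.log r) w ∂μ := by
        rw [integral_indicator_const _ hm, smul_eq_mul, mul_comm]
    _ ≤ _ := by
        refine integral_mono ((integrable_const _).indicator hm)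
          (integrable_logAnnulus hr hrs μ) fun w => ?_
        by_cases hw : w ∈ Metric.ball a r
        · rw [Set.indicator_of_mem hw, logAnnulus_of_norm_le hrs (mem_ball_iff_norm.1 hw).le]
        · rw [Set.indicator_of_notMem hw]
          exact logAnnulus_nonneg hr hrs

end logAnnulus

/-! ### Deterministic criterion for equidistribution of the zeros -/

/-- The difference of the linear statistics of the zeros and of the points is the difference of two
circle averages of the logarithm of the weighted Cauchy transform. -/
theorem sum_roots_logAnnulus {n : ℕ} {z : Fin n → ℂ} {c : Fin n → ℝ} {a : ℂ} {r s : ℝ}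
    (hr : 0 < r) (hs : 0 < s) (hzr : ∀ k, ‖z k - a‖ ≠ r) (hzs : ∀ k, ‖z k - a‖ ≠ s)
    (hQ : weightedDerivative z c ≠ 0) :
    ((weightedDerivative z c).roots.map (logAnnulus a r s)).sum =
      ∑ k, logAnnulus a r s (z k) +
        (Real.circleAverage (fun w => Real.log ‖cauchySum z c w‖) a s -
          Real.circleAverage (fun w => Real.log ‖cauchySum z c w‖) a r) := by
  -- The leading coefficient appears at both radii and cancels, so no control of it is needed.
  rw [circleAverage_log_norm_cauchySum hr hzr hQ, circleAverage_log_norm_cauchySum hs hzs hQ]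
  have h1 : ((weightedDerivative z c).roots.map (logAnnulus a r s)).sum =
      ((weightedDerivative z c).roots.map fun w => Real.log (max s ‖w - a‖)).sum -
      ((weightedDerivative z c).roots.map fun w => Real.log (max r ‖w - a‖)).sum := by
    rw [← Multiset.sum_map_sub]; rfl
  rw [h1]
  simp only [logAnnulus, Finset.sum_sub_distrib]
  ring

/-- There are at most `n` roots and the test function is nonnegative, so dividing by `n` instead of
the number of roots errs in the harmless direction. -/
theorem sum_roots_logAnnulus_le {n : ℕ} (z : Fin n → ℂ) (c : Fin n → ℝ) {a : ℂ} {r s : ℝ}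
    (hr : 0 < r) (hrs : r ≤ s) :
    (n : ℝ)⁻¹ * ((weightedDerivative z c).roots.map (logAnnulus a r s)).sum ≤
      ∫ w, logAnnulus a r s w ∂(zeroMeasure z c : Measure ℂ) := by
  rw [zeroMeasure, integral_empiricalMeasure]
  rcases Multiset.empty_or_exists_mem (weightedDerivative z c).roots with h | ⟨w, hw⟩
  · simp [h]
  · have hc : 0 < Multiset.card (weightedDerivative z c).roots :=
      Multiset.card_pos_iff_exists_mem.2 ⟨w, hw⟩
    refine mul_le_mul_of_nonneg_right ?_ (Multiset.sum_nonneg fun x hx => ?_)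
    · exact inv_anti₀ (by exact_mod_cast hc)
        (by exact_mod_cast card_roots_weightedDerivative_le z c)
    · obtain ⟨w, -, rfl⟩ := Multiset.mem_map.1 hx
      exact logAnnulus_nonneg hr hrs

theorem exists_lt_measureReal_ball (μ : Measure ℂ) [IsFiniteMeasure μ] (x : ℂ) {r : ℝ}
    (hr : 0 < r) {ε : ℝ} (hε : 0 < ε) :
    ∃ ρ, 0 < ρ ∧ ρ < r ∧ μ.real (Metric.ball x r) - ε < μ.real (Metric.ball x ρ) := by
  obtain ⟨u, hu, hur, hlim⟩ := exists_seq_strictMono_tendsto' hr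
  have hU : ⋃ n, Metric.ball x (u n) = Metric.ball x r := by
    refine Set.Subset.antisymm (Set.iUnion_subset fun n =>
      Metric.ball_subset_ball (hur n).2.le) fun y hy => ?_
    obtain ⟨n, hn⟩ := ((tendsto_order.1 hlim).1 _ (Metric.mem_ball.1 hy)).exists
    exact Set.mem_iUnion.2 ⟨n, hn⟩
  have ht := tendsto_measure_iUnion_atTop (μ := μ) (s := fun n => Metric.ball x (u n))
    fun i j hij => Metric.ball_subset_ball (hu.monotone hij)
  rw [hU] at ht
  have ht' := (ENNReal.tendsto_toReal (measure_ne_top μ _)).comp ht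
  obtain ⟨n, hn⟩ := ((tendsto_order.1 ht').1 _ (sub_lt_self (μ.real (Metric.ball x r)) hε)).exists
  exact ⟨u n, (hur n).1, (hur n).2, hn⟩

/-- If the points equidistribute with respect to `μ` and, on sufficiently many circles, the circle
averages of the logarithm of the weighted Cauchy transform are `o(n)`, then the zeros of the
weighted derivatives equidistribute with respect to `μ`. -/
theorem tendsto_zeroMeasure_of_circleAverage {z : (n : ℕ) → Fin n → ℂ} {c : (n : ℕ) → Fin n → ℝ}
    {μ : FiniteMeasure ℂ} (hμ : Tendsto (fun n => pointMeasure (z n)) atTop (𝓝 μ))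
    {D : Set ℂ} (hD : Dense D) {E : ℂ → Set ℝ}
    (hE : ∀ a ∈ D, ∀ s t : ℝ, 0 < s → s < t → ∃ r ∈ E a, s < r ∧ r < t)
    (hQ : ∀ᶠ n in atTop, weightedDerivative (z n) (c n) ≠ 0)
    (hz : ∀ a ∈ D, ∀ r ∈ E a, ∀ᶠ n in atTop, ∀ k, ‖z n k - a‖ ≠ r)
    (h : ∀ a ∈ D, ∀ r ∈ E a, Tendsto (fun n : ℕ =>
      (n : ℝ)⁻¹ * Real.circleAverage (fun w => Real.log ‖cauchySum (z n) (c n) w‖) a r)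
      atTop (𝓝 0)) :
    Tendsto (fun n => zeroMeasure (z n) (c n)) atTop (𝓝 μ) := by
  refine FiniteMeasure.tendsto_of_forall_ball (mass_eq_one_of_tendsto_pointMeasure hμ)
    (fun n => mass_empiricalMeasure_le_one _) fun x R hR ε hε => ?_
  -- The ball is shrunk to radius `ρ` at small cost in mass. The gap `R - ρ` is cut into quarters:
  -- one absorbs the move of the centre to `a ∈ D`, and `r < s` are taken in the two middle ones,
  -- which gives `hsub1` and `hsub2`.
  obtain ⟨ρ, hρ, hρR, hρε⟩ := exists_lt_measureReal_ball (μ : Measure ℂ) x hR (half_pos hε)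
  obtain ⟨a, ha, hxa⟩ := hD.exists_dist_lt x (show 0 < (R - ρ) / 4 by linarith)
  obtain ⟨r, hrE, hr1, hr2⟩ := hE a ha (ρ + (R - ρ) / 4) (ρ + (R - ρ) / 2) (by linarith)
    (by linarith)
  obtain ⟨s, hsE, hs1, hs2⟩ := hE a ha (ρ + (R - ρ) / 2) (R - (R - ρ) / 4) (by linarith)
    (by linarith)
  have hr : 0 < r := by linarith
  have hrs : r < s := by linarith
  have hs : 0 < s := hr.trans hrs
  set L := Real.log s - Real.log r
  have hLpos : 0 < L := sub_pos.2 (Real.log_lt_log hr hrs)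
  have hsub1 : Metric.ball x ρ ⊆ Metric.ball a r :=
    Metric.ball_subset_ball' (by linarith)
  have hsub2 : Metric.closedBall a s ⊆ Metric.closedBall x R :=
    Metric.closedBall_subset_closedBall' (by rw [dist_comm]; linarith)
  have hpt : Tendsto (fun n : ℕ => (n : ℝ)⁻¹ * ∑ k, logAnnulus a r s (z n k)) atTop
      (𝓝 (∫ w, logAnnulus a r s w ∂(μ : Measure ℂ))) := by
    have := FiniteMeasure.tendsto_iff_forall_integral_tendsto.1 hμ
      (BoundedContinuousFunction.ofNormedAddCommGroup (logAnnulus a r s)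
        (continuous_logAnnulus hr hrs.le) L fun w => by
          rw [Real.norm_of_nonneg (logAnnulus_nonneg hr hrs.le)]; exact logAnnulus_le hr hrs.le)
    simpa [integral_pointMeasure] using this
  have hlim := hpt.add ((h a ha s hsE).sub (h a ha r hrE))
  rw [sub_zero, add_zero] at hlim
  have hlow := le_integral_logAnnulus (a := a) hr hrs.le (μ : Measure ℂ)
  have hmono : (μ : Measure ℂ).real (Metric.ball x ρ) ≤ (μ : Measure ℂ).real (Metric.ball a r) :=
    measureReal_mono hsub1
  filter_upwards [(tendsto_order.1 hlim).1 (L * ((μ : Measure ℂ).real (Metric.ball x R) - ε)) (by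
      refine lt_of_lt_of_le ?_ hlow
      exact mul_lt_mul_of_pos_left (by linarith) hLpos), hQ, hz a ha r hrE, hz a ha s hsE]
    with n hn hQn hzr hzs
  rw [← mul_sub, ← mul_add, ← sum_roots_logAnnulus hr hs hzr hzs hQn] at hn
  have hchain := (hn.trans_le (sum_roots_logAnnulus_le (z n) (c n) hr hrs.le)).trans_le
    (integral_logAnnulus_le hr hrs.le _)
  exact (lt_of_mul_lt_mul_left hchain hLpos.le).le.trans (measureReal_mono hsub2)

/-! ### Moments of the Gamma distribution -/

theorem integrable_indicator_abs_rpow {p : ℝ} (hp : -1 < p) :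
    Integrable ((Set.Ioo (-1 : ℝ) 1).indicator fun t : ℝ => |t| ^ p) := by
  have h1 : IntervalIntegrable (fun t : ℝ => |t| ^ p) volume 0 1 := by
    refine (intervalIntegral.intervalIntegrable_rpow' hp).congr fun t ht => ?_
    rw [Set.uIoc_of_le zero_le_one] at ht
    simp only [abs_of_pos ht.1]
  have h2 : IntervalIntegrable (fun t : ℝ => |t| ^ p) volume (-1) 0 := by
    rw [IntervalIntegrable.iff_comp_neg]
    simpa using h1.symm
  have h3 := (h2.trans h1).1
  exact (integrable_indicator_iff measurableSet_Ioo).2 (h3.mono_set Set.Ioo_subset_Ioc_self)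

theorem exists_rpow_mul_exp_neg_le {p : ℝ} (hp : 0 ≤ p) :
    ∃ K : ℝ, 0 < K ∧ ∀ t : ℝ, 0 < t → t ^ p * Real.exp (-t) ≤ K := by
  obtain ⟨n, hn⟩ := exists_nat_ge p
  refine ⟨1 + n.factorial, by positivity, fun t ht => ?_⟩
  rw [Real.exp_neg, mul_inv_le_iff₀ (Real.exp_pos t)]
  have h1 : 1 ≤ Real.exp t := Real.one_le_exp ht.le
  have h2 := Real.pow_div_factorial_le_exp t ht.le n
  rw [div_le_iff₀ (by positivity)] at h2
  have h3 : (0 : ℝ) < n.factorial := by positivity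
  rcases le_total t 1 with h | h
  · have : t ^ p ≤ 1 := Real.rpow_le_one ht.le h hp
    nlinarith
  · have : t ^ p ≤ t ^ (n : ℝ) := Real.rpow_le_rpow_of_exponent_le h hn
    rw [Real.rpow_natCast] at this
    nlinarith

/-- Pointwise bound for the Gamma density weighted by `|t - x|⁻ᵅ`. -/
theorem exists_rpow_mul_gammaPDFReal_le {b : ℝ} (hb : 0 < b) :
    ∃ α : ℝ, 0 < α ∧ ∃ s : ℝ, -1 < s ∧ ∃ K : ℝ, 0 < K ∧ ∀ x t : ℝ, t ≠ 0 → t ≠ x →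
      |t - x| ^ (-α) * gammaPDFReal b 1 t ≤ gammaPDFReal b 1 t +
        K * ((Set.Ioo (-1 : ℝ) 1).indicator (fun v : ℝ => |v| ^ s) (t - x) +
          (Set.Ioo (-1 : ℝ) 1).indicator (fun v : ℝ => |v| ^ s) t) := by
  set d := min b 1
  have hd0 : 0 < d := lt_min hb one_pos
  have hd1 : d ≤ 1 := min_le_right _ _
  have hdb : d ≤ b := min_le_left _ _
  obtain ⟨K, hK, hKt⟩ := exists_rpow_mul_exp_neg_le (sub_nonneg.2 hdb)
  have hΓ := Real.Gamma_pos_of_pos hb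
  -- Since `d ≤ b` and `d ≤ 1`, the density is at most a constant times `t ^ (d - 1)`, with
  -- nonpositive exponent. Multiplying by the power `-d / 2` gives total exponent `-(1 - d / 2) >
  -- -1`, still integrable at 0.
  refine ⟨d / 2, by positivity, -(1 - d / 2), by linarith, K / Real.Gamma b, by positivity,
    fun x t ht0 htx => ?_⟩
  have hind : ∀ v : ℝ, 0 ≤ (Set.Ioo (-1 : ℝ) 1).indicator
      (fun v : ℝ => |v| ^ (-(1 - d / 2))) v := fun v =>
    Set.indicator_nonneg (fun v _ => by positivity) v
  rcases lt_or_gt_of_ne ht0 with ht | ht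
  · have : gammaPDFReal b 1 t = 0 := if_neg (not_le.2 ht)
    rw [this, mul_zero, zero_add]
    exact mul_nonneg (by positivity) (add_nonneg (hind _) (hind _))
  have hpdf : 0 ≤ gammaPDFReal b 1 t := gammaPDFReal_nonneg hb one_pos t
  have hu : 0 < |t - x| := abs_pos.2 (sub_ne_zero.2 htx)
  rcases le_or_gt 1 |t - x| with h1 | h1
  · have : |t - x| ^ (-(d / 2)) ≤ 1 := Real.rpow_le_one_of_one_le_of_nonpos h1 (by linarith)
    have h2 : 0 ≤ K / Real.Gamma b * ((Set.Ioo (-1 : ℝ) 1).indicator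
        (fun v : ℝ => |v| ^ (-(1 - d / 2))) (t - x) + (Set.Ioo (-1 : ℝ) 1).indicator
        (fun v : ℝ => |v| ^ (-(1 - d / 2))) t) :=
      mul_nonneg (by positivity) (add_nonneg (hind _) (hind _))
    nlinarith
  · have hle : gammaPDFReal b 1 t ≤ K / Real.Gamma b * t ^ (d - 1) := by
      have hsplit : t ^ (b - 1) = t ^ (d - 1) * t ^ (b - d) := by
        rw [← Real.rpow_add ht]; ring_nf
      rw [gammaPDFReal, if_pos ht.le, Real.one_rpow, one_mul, hsplit]
      calc 1 / Real.Gamma b * (t ^ (d - 1) * t ^ (b - d)) * Real.exp (-t)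
          = (t ^ (b - d) * Real.exp (-t)) * (t ^ (d - 1) / Real.Gamma b) := by ring
        _ ≤ K * (t ^ (d - 1) / Real.Gamma b) :=
          mul_le_mul_of_nonneg_right (hKt t ht) (by positivity)
        _ = _ := by ring
    have hmin : |t - x| ^ (-(d / 2)) * t ^ (d - 1) ≤ (Set.Ioo (-1 : ℝ) 1).indicator
        (fun v : ℝ => |v| ^ (-(1 - d / 2))) (t - x) + (Set.Ioo (-1 : ℝ) 1).indicator
        (fun v : ℝ => |v| ^ (-(1 - d / 2))) t := by
      -- Both powers are nonincreasing, so the product is at most the combined power of the smaller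
      -- of `|t - x|` and `t`.
      rcases le_total |t - x| t with h | h
      · rw [Set.indicator_of_mem (show t - x ∈ Set.Ioo (-1 : ℝ) 1 from abs_lt.1 h1)]
        refine le_add_of_le_of_nonneg ?_ (hind t)
        have : t ^ (d - 1) ≤ |t - x| ^ (d - 1) :=
          Real.rpow_le_rpow_of_nonpos hu h (by linarith)
        refine (mul_le_mul_of_nonneg_left this (by positivity)).trans_eq ?_
        rw [← Real.rpow_add hu]; ring_nf
      · have htm : t ∈ Set.Ioo (-1 : ℝ) 1 := ⟨by linarith, h.trans_lt h1⟩
        rw [Set.indicator_of_mem htm, abs_of_pos ht]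
        refine le_add_of_nonneg_of_le (hind _) ?_
        have : |t - x| ^ (-(d / 2)) ≤ t ^ (-(d / 2)) :=
          Real.rpow_le_rpow_of_nonpos ht h (by linarith)
        refine (mul_le_mul_of_nonneg_right this (by positivity)).trans_eq ?_
        rw [← Real.rpow_add ht]; ring_nf
    calc |t - x| ^ (-(d / 2)) * gammaPDFReal b 1 t
        ≤ |t - x| ^ (-(d / 2)) * (K / Real.Gamma b * t ^ (d - 1)) :=
          mul_le_mul_of_nonneg_left hle (by positivity)
      _ = K / Real.Gamma b * (|t - x| ^ (-(d / 2)) * t ^ (d - 1)) := by ring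
      _ ≤ _ := le_add_of_nonneg_of_le hpdf (mul_le_mul_of_nonneg_left hmin (by positivity))

/-- Negative moments of small order of the distance to a Gamma variable are bounded uniformly in the
base point. -/
theorem exists_lintegral_gammaMeasure_inv_enorm_sub_le {b : ℝ} (hb : 0 < b) :
    ∃ α : ℝ, 0 < α ∧ ∃ M : ENNReal, M ≠ ⊤ ∧ ∀ w : ℂ,
      ∫⁻ t, (‖(t : ℂ) - w‖ₑ ^ α)⁻¹ ∂gammaMeasure b 1 ≤ M := by
  obtain ⟨α, hα, s, hs, K, hK, hbound⟩ := exists_rpow_mul_gammaPDFReal_le hb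
  set H : ℝ → ℝ := (Set.Ioo (-1 : ℝ) 1).indicator fun v : ℝ => |v| ^ s
  have hHint : Integrable H := integrable_indicator_abs_rpow hs
  have hH0 : ∀ v, 0 ≤ H v := fun v => Set.indicator_nonneg (fun v _ => by positivity) v
  have hHm : Measurable H :=
    (measurable_norm.pow_const s).indicator measurableSet_Ioo
  set J := ∫⁻ t, ENNReal.ofReal (H t)
  have hJtop : J ≠ ⊤ := hHint.lintegral_lt_top.ne
  refine ⟨α, hα, 1 + ENNReal.ofReal K * (J + J), by finiteness, fun w => ?_⟩
  have hpdfm : Measurable (gammaPDF b 1) := (measurable_gammaPDFReal b 1).ennreal_ofReal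
  have hgm : Measurable fun t : ℝ => (‖(t : ℂ) - w‖ₑ ^ α)⁻¹ := by fun_prop
  rw [gammaMeasure, lintegral_withDensity_eq_lintegral_mul _ hpdfm hgm]
  calc ∫⁻ t, (gammaPDF b 1 * fun t : ℝ => (‖(t : ℂ) - w‖ₑ ^ α)⁻¹) t
      ≤ ∫⁻ t, (gammaPDF b 1 t + ENNReal.ofReal K *
          (ENNReal.ofReal (H (t - w.re)) + ENNReal.ofReal (H t))) := by
        have hne : ∀ y : ℝ, ∀ᵐ t : ℝ, t ≠ y := fun y => by
          simp [ae_iff]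
        refine lintegral_mono_ae ?_
        filter_upwards [hne 0, hne w.re] with t ht0 htw
        have hu : 0 < |t - w.re| := abs_pos.2 (sub_ne_zero.2 htw)
        have h1 : ENNReal.ofReal |t - w.re| ≤ ‖(t : ℂ) - w‖ₑ := by
          rw [← ofReal_norm]
          refine ENNReal.ofReal_le_ofReal ?_
          simpa using Complex.abs_re_le_norm ((t : ℂ) - w)
        have h2 : (‖(t : ℂ) - w‖ₑ ^ α)⁻¹ ≤ ENNReal.ofReal (|t - w.re| ^ (-α)) := by
          rw [← ENNReal.ofReal_rpow_of_pos hu, ENNReal.rpow_neg]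
          exact ENNReal.inv_le_inv.2 (ENNReal.rpow_le_rpow h1 hα.le)
        rw [Pi.mul_apply, mul_comm]
        refine (mul_le_mul_left h2 _).trans ?_
        rw [gammaPDF, ← ENNReal.ofReal_mul (by positivity),
          ← ENNReal.ofReal_add (hH0 _) (hH0 _), ← ENNReal.ofReal_mul hK.le,
          ← ENNReal.ofReal_add (gammaPDFReal_nonneg hb one_pos t)
            (mul_nonneg hK.le (add_nonneg (hH0 _) (hH0 _)))]
        exact ENNReal.ofReal_le_ofReal (hbound w.re t ht0 htw)
    _ = _ := by
        -- Translation invariance of Lebesgue measure makes the bound independent of `w`.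
        rw [lintegral_add_left hpdfm, lintegral_gammaPDF_eq_one hb one_pos,
          lintegral_const_mul _ (by fun_prop), lintegral_add_left (by fun_prop),
          lintegral_sub_right_eq_self (fun t => ENNReal.ofReal (H t)) w.re]

/-- Multiplying the Gamma density of parameter `b` by `t` gives a constant multiple of the density
of parameter `b + 1`. -/
theorem lintegral_gammaMeasure_enorm_ne_top {b : ℝ} (hb : 0 < b) :
    ∫⁻ t, ‖t‖ₑ ∂gammaMeasure b 1 ≠ ⊤ := by
  have hpdfm : Measurable (gammaPDF b 1) := (measurable_gammaPDFReal b 1).ennreal_ofReal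
  rw [gammaMeasure, lintegral_withDensity_eq_lintegral_mul _ hpdfm (by fun_prop)]
  have hb1 : 0 < b + 1 := by linarith
  have hΓ := Real.Gamma_pos_of_pos hb
  have hΓ' := Real.Gamma_pos_of_pos hb1
  refine ne_top_of_le_ne_top (b := ∫⁻ t, ENNReal.ofReal (Real.Gamma (b + 1) / Real.Gamma b) *
    gammaPDF (b + 1) 1 t) ?_ (lintegral_mono fun t => ?_)
  · have hm : Measurable (gammaPDF (b + 1) 1) := (measurable_gammaPDFReal _ _).ennreal_ofReal
    rw [lintegral_const_mul _ hm, lintegral_gammaPDF_eq_one hb1 one_pos]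
    finiteness
  · rw [Pi.mul_apply]
    rcases lt_trichotomy t 0 with ht | rfl | ht
    · simp [gammaPDF_of_neg ht]
    · simp
    · rw [gammaPDF_of_nonneg ht.le, gammaPDF_of_nonneg ht.le, Real.enorm_eq_ofReal ht.le,
        ← ENNReal.ofReal_mul (by positivity), ← ENNReal.ofReal_mul (by positivity)]
      refine ENNReal.ofReal_le_ofReal (le_of_eq ?_)
      have : t ^ (b + 1 - 1) = t ^ (b - 1) * t := by
        rw [← Real.rpow_add_one ht.ne']; ring_nf
      rw [this]
      simp only [Real.one_rpow, one_mul]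
      field_simp

/-! ### Negative moments of the weighted Cauchy transform -/

/-- A bound, uniform in the other coordinates, for the integral in one coordinate bounds the integral
with respect to a product of probability measures. -/
theorem lintegral_pi_le_of_update {ι : Type*} [Fintype ι] [DecidableEq ι] {X : ι → Type*}
    [∀ i, MeasurableSpace (X i)] {μ : ∀ i, Measure (X i)} [∀ i, IsProbabilityMeasure (μ i)]
    {f : (∀ i, X i) → ENNReal} (hf : Measurable f) (k : ι) {M : ENNReal}
    (h : ∀ c, ∫⁻ t, f (Function.update c k t) ∂μ k ≤ M) :
    ∫⁻ c, f c ∂Measure.pi μ ≤ M := by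
  have hne : Nonempty (∀ i, X i) := ⟨fun i => (nonempty_of_isProbabilityMeasure (μ i)).some⟩
  rw [lintegral_eq_lmarginal_univ hne.some, lmarginal_erase' f hf (Finset.mem_univ k)]
  refine (lmarginal_mono (g := fun _ => M) h _).trans ?_
  simp [lmarginal]

/-- The sum is affine in one weight: up to the factor `(w - z k)⁻¹` it is the distance from `t` to a
complex number fixed by the other weights. A moment bound uniform in the base point therefore
applies whatever these are. -/
theorem cauchySum_update {n : ℕ} (z : Fin n → ℂ) (c : Fin n → ℝ) (k : Fin n) {w : ℂ}
    (hw : w ≠ z k) (t : ℝ) :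
    cauchySum z (Function.update c k t) w =
      (w - z k)⁻¹ * (t - -((w - z k) * ∑ j ∈ Finset.univ.erase k, (c j : ℂ) * (w - z j)⁻¹)) := by
  have hw' : w - z k ≠ 0 := sub_ne_zero.2 hw
  rw [cauchySum, ← Finset.add_sum_erase _ _ (Finset.mem_univ k), Function.update_self,
    sub_neg_eq_add, mul_add, inv_mul_cancel_left₀ hw', mul_comm]
  congr 1
  refine Finset.sum_congr rfl fun j hj => ?_
  rw [Function.update_of_ne (Finset.ne_of_mem_erase hj)]

theorem measurable_cauchySum {n : ℕ} :
    Measurable fun p : ((Fin n → ℂ) × (Fin n → ℝ)) × ℂ => cauchySum p.1.1 p.1.2 p.2 := by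
  unfold cauchySum
  fun_prop

/-- Negative moments of the weighted Cauchy transform for independent weights. -/
theorem lintegral_inv_enorm_cauchySum_le {m : Measure ℝ} [IsProbabilityMeasure m] {α : ℝ}
    (hα : 0 < α) {M : ENNReal} (hM : ∀ v : ℂ, ∫⁻ t, (‖(t : ℂ) - v‖ₑ ^ α)⁻¹ ∂m ≤ M)
    {n : ℕ} (z : Fin n → ℂ) (k : Fin n) {w : ℂ} (hw : w ≠ z k) :
    ∫⁻ c, (‖cauchySum z c w‖ₑ ^ α)⁻¹ ∂Measure.pi (fun _ : Fin n => m) ≤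
      ‖w - z k‖ₑ ^ α * M := by
  have hw' : w - z k ≠ 0 := sub_ne_zero.2 hw
  have hm : Measurable fun c : Fin n → ℝ => (‖cauchySum z c w‖ₑ ^ α)⁻¹ := by
    unfold cauchySum
    fun_prop
  refine lintegral_pi_le_of_update hm k fun c => ?_
  simp_rw [cauchySum_update z c k hw]
  have h0 : ‖w - z k‖ₑ ^ α ≠ ⊤ := by finiteness
  have h0' : ‖w - z k‖ₑ ≠ 0 := by simpa using hw'
  have heq : ∀ x : ℂ, (‖(w - z k)⁻¹ * x‖ₑ ^ α)⁻¹ = ‖w - z k‖ₑ ^ α * (‖x‖ₑ ^ α)⁻¹ := by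
    intro x
    rw [enorm_mul, enorm_inv hw', ENNReal.mul_rpow_of_nonneg _ _ hα.le, ENNReal.inv_rpow,
      ENNReal.mul_inv, inv_inv]
    · left
      simpa using h0
    · left
      rw [ENNReal.inv_ne_top]
      simp [ENNReal.rpow_eq_zero_iff, h0', not_lt.2 hα.le]
  simp_rw [heq]
  rw [lintegral_const_mul' _ _ h0]
  gcongr
  exact hM _

/-! ### Deterministic bounds on the circle averages -/

theorem circleIntegrable_log_norm_cauchySum {n : ℕ} (z : Fin n → ℂ) (c : Fin n → ℝ) (a : ℂ)
    (r : ℝ) : CircleIntegrable (fun w => Real.log ‖cauchySum z c w‖) a r := by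
  refine MeromorphicOn.circleIntegrable_log_norm fun w _ => ?_
  unfold cauchySum
  fun_prop

theorem circleAverage_log_norm_cauchySum_le {n : ℕ} {z : Fin n → ℂ} {c : Fin n → ℝ} {a : ℂ}
    {r δ T : ℝ} (hr : 0 < r) (hδ : 0 < δ) (hz : ∀ k, δ ≤ |‖z k - a‖ - r|) (hT : 1 ≤ T)
    (hc : ∑ k, |c k| ≤ δ * T) :
    Real.circleAverage (fun w => Real.log ‖cauchySum z c w‖) a r ≤ Real.log T := by
  refine Real.circleAverage_mono_on_of_le_circle (circleIntegrable_log_norm_cauchySum z c a r)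
    fun w hw => ?_
  rw [mem_sphere_iff_norm, abs_of_pos hr] at hw
  have hS : ‖cauchySum z c w‖ ≤ T := by
    calc ‖cauchySum z c w‖ ≤ ∑ k, |c k| * δ⁻¹ := by
          refine norm_sum_le_of_le _ fun k _ => ?_
          rw [norm_mul, norm_inv, Complex.norm_real, Real.norm_eq_abs]
          have : δ ≤ ‖w - z k‖ := by
            refine (hz k).trans ?_
            rw [← hw]
            refine (abs_norm_sub_norm_le _ _).trans_eq ?_
            rw [sub_sub_sub_cancel_right, norm_sub_rev]
          gcongr
      _ = (∑ k, |c k|) * δ⁻¹ := by rw [Finset.sum_mul]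
      _ ≤ (δ * T) * δ⁻¹ := by gcongr
      _ = T := by field_simp
  -- At a zero of the sum `Real.log 0 = 0`, which is where `1 ≤ T` is used.
  rcases (norm_nonneg (cauchySum z c w)).eq_or_lt with h | h
  · rw [← h, Real.log_zero]
    exact Real.log_nonneg hT
  · exact Real.log_le_log h hS

/-- If the polynomial vanished identically, so would the Cauchy sum on the circle, and the integrand
would be `⊤` everywhere. -/
theorem weightedDerivative_ne_zero_of_lintegral {n : ℕ} {z : Fin n → ℂ} {c : Fin n → ℝ} {a : ℂ}
    {r α : ℝ} (hr : 0 < r) (hα : 0 < α) (hz : ∀ k, ‖z k - a‖ ≠ r)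
    (hI : ∫⁻ θ in Set.Ioc 0 (2 * Real.pi), (‖cauchySum z c (circleMap a r θ)‖ₑ ^ α)⁻¹ ≠ ⊤) :
    weightedDerivative z c ≠ 0 := by
  intro hQ
  refine hI ?_
  have h0 : ∀ θ, cauchySum z c (circleMap a r θ) = 0 := by
    intro θ
    have hw : ∀ k, circleMap a r θ ≠ z k := fun k h => hz k (by
      rw [← h, ← dist_eq_norm, circleMap_mem_sphere a hr.le θ])
    have := eval_weightedDerivative c hw
    rw [hQ, eval_zero, eq_comm, mul_eq_zero] at this
    refine this.resolve_left (Finset.prod_ne_zero_iff.2 fun k _ => sub_ne_zero.2 (hw k))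
  simp [h0, hα, Real.pi_pos, ENNReal.top_mul, ENNReal.ofReal_eq_zero, not_le]

/-- An elementary form of Jensen's inequality: `log x ≤ x - 1` at `x = T⁻¹ |S| ^ (-α)`, integrated
over the circle. The `1` in the bound is a crude replacement for `1 / (2π)`. -/
theorem le_circleAverage_log_norm_cauchySum {n : ℕ} {z : Fin n → ℂ} {c : Fin n → ℝ} {a : ℂ}
    {r α T : ℝ} (hα : 0 < α) (hT : 1 ≤ T)
    (hI : ∫⁻ θ in Set.Ioc 0 (2 * Real.pi), (‖cauchySum z c (circleMap a r θ)‖ₑ ^ α)⁻¹ ≤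
      ENNReal.ofReal T) :
    -(Real.log T + 1) / α ≤
      Real.circleAverage (fun w => Real.log ‖cauchySum z c w‖) a r := by
  set S : ℝ → ℂ := fun θ => cauchySum z c (circleMap a r θ) with hS
  have hSm : Measurable S := by
    simp only [hS]
    unfold cauchySum
    fun_prop
  have hT0 : 0 < T := one_pos.trans_le hT
  have h2pi : (0 : ℝ) ≤ 2 * Real.pi := by positivity
  have hle : ∀ θ, ENNReal.ofReal (‖S θ‖ ^ (-α)) ≤ (‖S θ‖ₑ ^ α)⁻¹ := by
    intro θ
    rcases (norm_nonneg (S θ)).eq_or_lt with h | h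
    · rw [← h, Real.zero_rpow (by linarith)]
      simp
    · rw [← ENNReal.ofReal_rpow_of_pos h, ENNReal.rpow_neg, ofReal_norm]
  have hlint : ∫⁻ θ in Set.Ioc 0 (2 * Real.pi), ENNReal.ofReal (‖S θ‖ ^ (-α)) ≤
      ENNReal.ofReal T := (lintegral_mono hle).trans hI
  have hint : IntegrableOn (fun θ => ‖S θ‖ ^ (-α)) (Set.Ioc 0 (2 * Real.pi)) := by
    refine ⟨(hSm.norm.pow_const _).aestronglyMeasurable, ?_⟩
    rw [hasFiniteIntegral_iff_ofReal (ae_of_all _ fun θ => by positivity)]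
    exact hlint.trans_lt ENNReal.ofReal_lt_top
  have hval : ∫ θ in 0..2 * Real.pi, ‖S θ‖ ^ (-α) ≤ T := by
    rw [intervalIntegral.integral_of_le h2pi, integral_eq_lintegral_of_nonneg_ae
      (ae_of_all _ fun θ => by positivity) hint.1]
    exact ENNReal.toReal_le_of_le_ofReal hT0.le hlint
  have hint' : IntervalIntegrable (fun θ => ‖S θ‖ ^ (-α)) volume 0 (2 * Real.pi) :=
    (intervalIntegrable_iff_integrableOn_Ioc_of_le h2pi).2 hint
  have hlog : IntervalIntegrable (fun θ => Real.log ‖S θ‖) volume 0 (2 * Real.pi) :=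
    circleIntegrable_log_norm_cauchySum z c a r
  have hpt : ∀ θ, -α * Real.log ‖S θ‖ ≤ Real.log T + T⁻¹ * ‖S θ‖ ^ (-α) := by
    intro θ
    rcases (norm_nonneg (S θ)).eq_or_lt with h | h
    · rw [← h, Real.log_zero, Real.zero_rpow (by linarith)]
      simpa using Real.log_nonneg hT
    · have h1 : 0 < ‖S θ‖ ^ (-α) := Real.rpow_pos_of_pos h _
      have h2 := Real.log_le_sub_one_of_pos (show 0 < T⁻¹ * ‖S θ‖ ^ (-α) by positivity)
      rw [Real.log_mul (by positivity) h1.ne', Real.log_inv, Real.log_rpow h] at h2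
      linarith
  have hmono := intervalIntegral.integral_mono h2pi (hlog.const_mul (-α))
    ((intervalIntegrable_const (c := Real.log T)).add (hint'.const_mul T⁻¹)) hpt
  rw [intervalIntegral.integral_const_mul, intervalIntegral.integral_add intervalIntegrable_const
    (hint'.const_mul T⁻¹), intervalIntegral.integral_const, intervalIntegral.integral_const_mul,
    smul_eq_mul, sub_zero] at hmono
  have h1 : T⁻¹ * ∫ θ in 0..2 * Real.pi, ‖S θ‖ ^ (-α) ≤ 1 := by
    rw [inv_mul_le_iff₀ hT0]; linarith
  have h3 : Real.circleAverage (fun w => Real.log ‖cauchySum z c w‖) a r =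
      (2 * Real.pi)⁻¹ * ∫ θ in 0..2 * Real.pi, Real.log ‖S θ‖ := by
    rw [Real.circleAverage_def, smul_eq_mul]
  have hpi : 1 ≤ 2 * Real.pi := by linarith [Real.pi_gt_three]
  rw [h3, div_le_iff₀ hα, mul_assoc, ← div_eq_inv_mul, le_div_iff₀ (by positivity)]
  nlinarith [Real.log_nonneg hT]

/-! ### Borel–Cantelli estimates and a point in a fixed disc -/

/-- A Borel–Cantelli statement: nonnegative functions whose integrals grow at most linearly are
almost everywhere eventually smaller than every exponential. -/
theorem ae_eventually_lt_exp_of_lintegral_le {Ω : Type*} [MeasurableSpace Ω] {P : Measure Ω}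
    {f : ℕ → Ω → ENNReal} (hf : ∀ n, Measurable (f n)) {A : ENNReal} (hA : A ≠ ⊤)
    (h : ∀ n : ℕ, ∫⁻ ω, f n ω ∂P ≤ (n + 1 : ℕ) * A) {ε : ℝ} (hε : 0 < ε) :
    ∀ᵐ ω ∂P, ∀ᶠ n : ℕ in atTop, f n ω < ENNReal.ofReal (Real.exp (ε * n)) := by
  have hsum : ∑' n : ℕ, P {ω | ENNReal.ofReal (Real.exp (ε * n)) ≤ f n ω} ≠ ⊤ := by
    have hbd : ∀ n : ℕ, P {ω | ENNReal.ofReal (Real.exp (ε * n)) ≤ f n ω} ≤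
        ENNReal.ofReal ((n + 1) * Real.exp (-(ε * n))) * A := by
      intro n
      refine (meas_ge_le_lintegral_div (hf n).aemeasurable
        (by simp [Real.exp_pos]) ENNReal.ofReal_ne_top).trans ?_
      refine (ENNReal.div_le_div_right (h n) _).trans_eq ?_
      rw [ENNReal.ofReal_mul (by positivity), Real.exp_neg, ENNReal.ofReal_inv_of_pos
        (Real.exp_pos _), div_eq_mul_inv, mul_right_comm]
      congr 2
      rw [← Nat.cast_succ, ENNReal.ofReal_natCast]
    refine ne_top_of_le_ne_top ?_ (ENNReal.tsum_le_tsum hbd)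
    rw [ENNReal.tsum_mul_right]
    refine ENNReal.mul_ne_top (Summable.tsum_ofReal_ne_top ?_) hA
    have h1 := Real.summable_pow_mul_exp_neg_nat_mul 1 hε
    have h0 := Real.summable_pow_mul_exp_neg_nat_mul 0 hε
    refine (h1.add h0).congr fun n => ?_
    rw [pow_one, pow_zero, ← add_mul, neg_mul]
  filter_upwards [ae_eventually_notMem hsum] with ω hω
  filter_upwards [hω] with n hn
  exact not_le.1 hn

/-- Almost every real number eventually stays at distance at least `exp (-ε n)` from the `n` points
of the `n`-th row of a triangular array. -/
theorem ae_eventually_exp_le_abs_sub (x : (n : ℕ) → Fin n → ℝ) {ε : ℝ} (hε : 0 < ε) :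
    ∀ᵐ r : ℝ, ∀ᶠ n : ℕ in atTop, ∀ k, Real.exp (-(ε * n)) ≤ |x n k - r| := by
  have hsum : ∑' n : ℕ, volume (⋃ k, Metric.ball (x n k) (Real.exp (-(ε * n)))) ≠ ⊤ := by
    have hbd : ∀ n : ℕ, volume (⋃ k, Metric.ball (x n k) (Real.exp (-(ε * n)))) ≤
        ENNReal.ofReal (2 * (n * Real.exp (-(ε * n)))) := by
      intro n
      refine (measure_iUnion_fintype_le _ _).trans ?_
      simp only [Real.volume_ball, Finset.sum_const, Finset.card_univ, Fintype.card_fin,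
        nsmul_eq_mul]
      rw [← ENNReal.ofReal_natCast, ← ENNReal.ofReal_mul (by positivity)]
      exact (congrArg ENNReal.ofReal (by ring)).le
    refine ne_top_of_le_ne_top (Summable.tsum_ofReal_ne_top ?_) (ENNReal.tsum_le_tsum hbd)
    refine ((Real.summable_pow_mul_exp_neg_nat_mul 1 hε).mul_left 2).congr fun n => ?_
    rw [pow_one, neg_mul]
  filter_upwards [ae_eventually_notMem hsum] with r hr
  filter_upwards [hr] with n hn k
  have : r ∉ Metric.ball (x n k) (Real.exp (-(ε * n))) :=
    fun h => hn (Set.mem_iUnion.2 ⟨k, h⟩)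
  rwa [Metric.mem_ball, not_lt, dist_comm, Real.dist_eq] at this

/-- Some ball has positive `μ`-mass, and testing against a bump on a larger ball forces points into
it. The radius depends on `μ` alone, so one `R` serves almost every outcome. -/
theorem exists_eventually_norm_le_of_tendsto_pointMeasure {μ : FiniteMeasure ℂ} (hμ : μ.mass = 1) :
    ∃ R : ℝ, ∀ z : (n : ℕ) → Fin n → ℂ, Tendsto (fun n => pointMeasure (z n)) atTop (𝓝 μ) →
      ∀ᶠ n in atTop, ∃ k, ‖z n k‖ ≤ R := by
  obtain ⟨N, hN⟩ : ∃ N : ℕ, (μ : Measure ℂ) (Metric.ball 0 N) ≠ 0 := by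
    by_contra! h
    have h0 := measure_iUnion_null h
    rw [Metric.iUnion_ball_nat, ← FiniteMeasure.ennreal_mass, hμ] at h0
    simp at h0
  have hr : (0 : ℝ) < N + 1 := by positivity
  have hrs : (N + 1 : ℝ) < N + 2 := by linarith
  have hL : 0 < Real.log (N + 2) - Real.log (N + 1) := sub_pos.2 (Real.log_lt_log hr hrs)
  refine ⟨N + 2, fun z hz => ?_⟩
  have hpos : 0 < (μ : Measure ℂ).real (Metric.ball 0 (N + 1)) :=
    ENNReal.toReal_pos (fun h => hN (measure_mono_null (Metric.ball_subset_ball (by simp)) h))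
      (measure_ne_top _ _)
  have hlow := le_integral_logAnnulus (a := 0) hr hrs.le (μ : Measure ℂ)
  have hint := FiniteMeasure.tendsto_iff_forall_integral_tendsto.1 hz
    (BoundedContinuousFunction.ofNormedAddCommGroup (logAnnulus 0 (N + 1) (N + 2))
      (continuous_logAnnulus hr hrs.le) (Real.log (N + 2) - Real.log (N + 1)) fun w => by
        rw [Real.norm_of_nonneg (logAnnulus_nonneg hr hrs.le)]; exact logAnnulus_le hr hrs.le)
  simp only [BoundedContinuousFunction.coe_ofNormedAddCommGroup, integral_pointMeasure] at hint
  filter_upwards [(tendsto_order.1 hint).1 0 ((mul_pos hL hpos).trans_le hlow)] with n hn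
  by_contra! hcon
  have : ∑ k, logAnnulus 0 (N + 1 : ℝ) (N + 2) (z n k) = 0 :=
    Finset.sum_eq_zero fun k _ => logAnnulus_eq_zero hrs.le (by simpa using (hcon k).le)
  rw [this, mul_zero] at hn
  exact lt_irrefl _ hn

/-- The integral over a circle of a negative power of the weighted Cauchy transform, cut off to the
configurations with a point of norm at most `R` and no point on the circle. -/
noncomputable def circleInvMoment (α : ℝ) (a : ℂ) (r R : ℝ) {n : ℕ}
    (p : (Fin n → ℂ) × (Fin n → ℝ)) : ENNReal :=
  {z : Fin n → ℂ | (∃ k, ‖z k‖ ≤ R) ∧ ∀ k, ‖z k - a‖ ≠ r}.indicator (fun _ => 1) p.1 *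
    ∫⁻ θ in Set.Ioc 0 (2 * Real.pi), (‖cauchySum p.1 p.2 (circleMap a r θ)‖ₑ ^ α)⁻¹

theorem measurable_circleInvMoment (α : ℝ) (a : ℂ) (r R : ℝ) (n : ℕ) :
    Measurable (circleInvMoment α a r R (n := n)) := by
  have hset : MeasurableSet {z : Fin n → ℂ | (∃ k, ‖z k‖ ≤ R) ∧ ∀ k, ‖z k - a‖ ≠ r} := by
    have h1 : MeasurableSet {z : Fin n → ℂ | ∃ k, ‖z k‖ ≤ R} := by
      simp only [Set.ofPred_exists]
      exact MeasurableSet.iUnion fun k => measurableSet_le (by fun_prop) measurable_const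
    have h2 : MeasurableSet {z : Fin n → ℂ | ∀ k, ‖z k - a‖ ≠ r} := by
      simp only [Set.ofPred_forall]
      exact MeasurableSet.iInter fun k =>
        (measurableSet_eq_fun (by fun_prop) measurable_const).compl
    exact h1.inter h2
  refine ((measurable_const.indicator hset).comp measurable_fst).mul ?_
  refine Measurable.lintegral_prod_right' (f := fun q : ((Fin n → ℂ) × (Fin n → ℝ)) × ℝ =>
    (‖cauchySum q.1.1 q.1.2 (circleMap a r q.2)‖ₑ ^ α)⁻¹) ?_
  have : Measurable fun q : ((Fin n → ℂ) × (Fin n → ℝ)) × ℝ =>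
      cauchySum q.1.1 q.1.2 (circleMap a r q.2) :=
    measurable_cauchySum.comp (measurable_fst.prodMk
      ((continuous_circleMap a r).measurable.comp measurable_snd))
  fun_prop

/-- With the points frozen, Tonelli puts the weights inside the angular integral. The point `z k` of
norm at most `R` lies within `‖a‖ + r + R` of the circle, so the bound does not depend on `n`. -/
theorem lintegral_circleInvMoment_le {m : Measure ℝ} [IsProbabilityMeasure m] {α : ℝ}
    (hα : 0 < α) {M : ENNReal} (hM : ∀ v : ℂ, ∫⁻ t, (‖(t : ℂ) - v‖ₑ ^ α)⁻¹ ∂m ≤ M)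
    (a : ℂ) {r : ℝ} (hr : 0 < r) (R : ℝ) {n : ℕ} (ρ : Measure (Fin n → ℂ))
    [IsProbabilityMeasure ρ] :
    ∫⁻ p, circleInvMoment α a r R p ∂ρ.prod (Measure.pi fun _ => m) ≤
      ENNReal.ofReal (‖a‖ + r + R) ^ α * M * ENNReal.ofReal (2 * Real.pi) := by
  rw [lintegral_prod _ (measurable_circleInvMoment α a r R n).aemeasurable]
  refine (lintegral_mono (g := fun _ => ENNReal.ofReal (‖a‖ + r + R) ^ α * M *
    ENNReal.ofReal (2 * Real.pi)) fun z => ?_).trans (by simp)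
  simp only [circleInvMoment]
  by_cases hz : z ∈ {z : Fin n → ℂ | (∃ k, ‖z k‖ ≤ R) ∧ ∀ k, ‖z k - a‖ ≠ r}
  · simp only [Set.indicator_of_mem hz, one_mul]
    obtain ⟨⟨k, hk⟩, hzr⟩ := hz
    have hm : Measurable fun q : (Fin n → ℝ) × ℝ =>
        (‖cauchySum z q.1 (circleMap a r q.2)‖ₑ ^ α)⁻¹ := by
      have : Measurable fun q : (Fin n → ℝ) × ℝ => cauchySum z q.1 (circleMap a r q.2) :=
        measurable_cauchySum.comp ((measurable_const.prodMk measurable_fst).prodMk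
          ((continuous_circleMap a r).measurable.comp measurable_snd))
      fun_prop
    rw [lintegral_lintegral_swap hm.aemeasurable]
    refine (lintegral_mono (g := fun _ => ENNReal.ofReal (‖a‖ + r + R) ^ α * M)
      fun θ => ?_).trans (by simp)
    have hw : ‖circleMap a r θ - a‖ = r := by
      rw [← dist_eq_norm, circleMap_mem_sphere a hr.le θ]
    have hne : circleMap a r θ ≠ z k := fun h => hzr k (by rw [← h, hw])
    refine (lintegral_inv_enorm_cauchySum_le hα hM z k hne).trans ?_
    refine mul_le_mul_left (ENNReal.rpow_le_rpow ?_ hα.le) M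
    rw [← ofReal_norm]
    refine ENNReal.ofReal_le_ofReal ?_
    calc ‖circleMap a r θ - z k‖ = ‖a + (circleMap a r θ - a) - z k‖ := by congr 1; ring
      _ ≤ ‖a‖ + ‖circleMap a r θ - a‖ + ‖z k‖ :=
        (norm_sub_le _ _).trans (by gcongr; exact norm_add_le _ _)
      _ ≤ _ := by rw [hw]; gcongr
  · simp [Set.indicator_of_notMem hz]

/-! ### Almost sure estimates on a fixed circle -/

section RandomWeights

variable {Ω : Type*} [MeasurableSpace Ω] {P : Measure Ω}
  {Z : (n : ℕ) → Fin n → Ω → ℂ} {γ : (n : ℕ) → Fin n → Ω → ℝ} {m : Measure ℝ}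

theorem ae_eventually_circleInvMoment_lt [IsProbabilityMeasure P] [IsProbabilityMeasure m]
    (hZ : ∀ n k, Measurable (Z n k)) (hγ : ∀ n k, Measurable (γ n k))
    (hγlaw : ∀ n k, P.map (γ n k) = m) (hγindep : ∀ n, iIndepFun (γ n) P)
    (hZγ : ∀ n, IndepFun (fun ω k => Z n k ω) (fun ω k => γ n k ω) P)
    {α : ℝ} (hα : 0 < α) {M : ENNReal} (hMtop : M ≠ ⊤)
    (hM : ∀ v : ℂ, ∫⁻ t, (‖(t : ℂ) - v‖ₑ ^ α)⁻¹ ∂m ≤ M)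
    (a : ℂ) {r : ℝ} (hr : 0 < r) (R : ℝ) {ε : ℝ} (hε : 0 < ε) :
    ∀ᵐ ω ∂P, ∀ᶠ n : ℕ in atTop,
      circleInvMoment α a r R (fun k => Z n k ω, fun k => γ n k ω) <
        ENNReal.ofReal (Real.exp (ε * n)) := by
  have hmZ : ∀ n, Measurable fun ω k => Z n k ω := fun n => measurable_pi_lambda _ (hZ n)
  have hmγ : ∀ n, Measurable fun ω k => γ n k ω := fun n => measurable_pi_lambda _ (hγ n)
  refine ae_eventually_lt_exp_of_lintegral_le
    (A := ENNReal.ofReal (‖a‖ + r + R) ^ α * M * ENNReal.ofReal (2 * Real.pi))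
    (fun n => (measurable_circleInvMoment α a r R n).comp ((hmZ n).prodMk (hmγ n)))
    (by finiteness) (fun n => ?_) hε
  have hlaw : P.map (fun ω => ((fun k => Z n k ω), fun k => γ n k ω)) =
      (P.map fun ω k => Z n k ω).prod (Measure.pi fun _ => m) := by
    rw [(indepFun_iff_map_prod_eq_prod_map_map (hmZ n).aemeasurable (hmγ n).aemeasurable).1
      (hZγ n), (iIndepFun_iff_map_fun_eq_pi_map fun k => (hγ n k).aemeasurable).1 (hγindep n)]
    simp only [hγlaw]
  have : IsProbabilityMeasure (P.map fun ω k => Z n k ω) :=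
    Measure.isProbabilityMeasure_map (hmZ n).aemeasurable
  have hle := lintegral_circleInvMoment_le hα hM a hr R (P.map fun ω k => Z n k ω)
  rw [← hlaw, lintegral_map (measurable_circleInvMoment α a r R n) ((hmZ n).prodMk (hmγ n))]
    at hle
  refine hle.trans (le_mul_of_one_le_left zero_le ?_)
  exact_mod_cast Nat.succ_pos n

theorem ae_eventually_sum_abs_le (hγ : ∀ n k, Measurable (γ n k))
    (hγlaw : ∀ n k, P.map (γ n k) = m) (hm : ∫⁻ t, ‖t‖ₑ ∂m ≠ ⊤) {ε : ℝ} (hε : 0 < ε) :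
    ∀ᵐ ω ∂P, ∀ᶠ n : ℕ in atTop, ∑ k, |γ n k ω| ≤ Real.exp (ε * n) := by
  have h := ae_eventually_lt_exp_of_lintegral_le (P := P) (f := fun n ω => ∑ k, ‖γ n k ω‖ₑ)
    (fun n => Finset.measurable_sum _ fun k _ => (hγ n k).enorm) hm (fun n => ?_) hε
  · filter_upwards [h] with ω hω
    filter_upwards [hω] with n hn
    simp only [Real.enorm_eq_ofReal_abs] at hn
    rw [← ENNReal.ofReal_sum_of_nonneg fun k _ => abs_nonneg _] at hn
    exact (ENNReal.ofReal_lt_ofReal_iff (Real.exp_pos _)).1 hn |>.le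
  · rw [lintegral_finsetSum _ fun k _ => (hγ n k).enorm]
    have hk : ∀ k, ∫⁻ ω, ‖γ n k ω‖ₑ ∂P = ∫⁻ t, ‖t‖ₑ ∂m := fun k => by
      rw [← hγlaw n k, lintegral_map measurable_enorm (hγ n k)]
    simp only [hk, Finset.sum_const, Finset.card_univ, Fintype.card_fin, nsmul_eq_mul]
    gcongr
    exact Nat.le_succ n

/-- Nothing is known about the law of the points, so the randomness comes from the radius: for each
outcome almost every radius is good, and Fubini exchanges the quantifiers. -/
theorem ae_ae_eventually_exp_le_abs_sub [IsProbabilityMeasure P]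
    (hZ : ∀ n k, Measurable (Z n k)) (a : ℂ) {ε : ℝ} (hε : 0 < ε) :
    ∀ᵐ r : ℝ, ∀ᵐ ω ∂P, ∀ᶠ n : ℕ in atTop, ∀ k,
      Real.exp (-(ε * n)) ≤ |‖Z n k ω - a‖ - r| := by
  refine (Measure.ae_ae_comm ?_).1
    (ae_of_all P fun ω => ae_eventually_exp_le_abs_sub (fun n k => ‖Z n k ω - a‖) hε)
  simp only [eventually_atTop, Set.ofPred_exists, Set.ofPred_forall]
  refine MeasurableSet.iUnion fun N => MeasurableSet.iInter fun n => MeasurableSet.iInter fun _ =>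
    MeasurableSet.iInter fun k => measurableSet_le measurable_const ?_
  have := hZ n k
  fun_prop

/-- On almost every circle about `a`, almost surely, the weighted derivatives are eventually nonzero
and the circle average of the logarithm of the weighted Cauchy transform is `o(n)`. -/
theorem ae_ae_tendsto_circleAverage [IsProbabilityMeasure P] [IsProbabilityMeasure m]
    (hZ : ∀ n k, Measurable (Z n k)) (hγ : ∀ n k, Measurable (γ n k))
    (hγlaw : ∀ n k, P.map (γ n k) = m) (hγindep : ∀ n, iIndepFun (γ n) P)
    (hZγ : ∀ n, IndepFun (fun ω k => Z n k ω) (fun ω k => γ n k ω) P)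
    (hm : ∫⁻ t, ‖t‖ₑ ∂m ≠ ⊤) {α : ℝ} (hα : 0 < α) {M : ENNReal} (hMtop : M ≠ ⊤)
    (hM : ∀ v : ℂ, ∫⁻ t, (‖(t : ℂ) - v‖ₑ ^ α)⁻¹ ∂m ≤ M)
    {R : ℝ} (hR : ∀ᵐ ω ∂P, ∀ᶠ n in atTop, ∃ k, ‖Z n k ω‖ ≤ R) (a : ℂ) :
    ∀ᵐ r : ℝ, 0 < r → ∀ᵐ ω ∂P,
      (∀ᶠ n in atTop, weightedDerivative (fun k => Z n k ω) (fun k => γ n k ω) ≠ 0) ∧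
      (∀ᶠ n in atTop, ∀ k, ‖Z n k ω - a‖ ≠ r) ∧
      Tendsto (fun n : ℕ => (n : ℝ)⁻¹ * Real.circleAverage (fun w =>
        Real.log ‖cauchySum (fun k => Z n k ω) (fun k => γ n k ω) w‖) a r) atTop (𝓝 0) := by
  have hε : ∀ j : ℕ, (0 : ℝ) < 1 / (j + 1) := fun j => Nat.one_div_pos_of_nat
  filter_upwards [ae_all_iff.2 fun j => ae_ae_eventually_exp_le_abs_sub (P := P) hZ a (hε j)]
    with r hgeom hr
  filter_upwards [hR, ae_all_iff.2 hgeom,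
    ae_all_iff.2 fun j => ae_eventually_sum_abs_le hγ hγlaw hm (hε j),
    ae_all_iff.2 fun j => ae_eventually_circleInvMoment_lt hZ hγ hγlaw hγindep hZγ hα hMtop hM a hr
      R (hε j)] with ω hRω hgω hsω hmω
  have hne : ∀ᶠ n in atTop, ∀ k, ‖Z n k ω - a‖ ≠ r := by
    filter_upwards [hgω 0] with n hn k h
    have := hn k
    rw [h, sub_self, abs_zero] at this
    exact (Real.exp_pos _).not_ge this
  have hI : ∀ j : ℕ, ∀ᶠ n : ℕ in atTop, ∫⁻ θ in Set.Ioc 0 (2 * Real.pi),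
      (‖cauchySum (fun k => Z n k ω) (fun k => γ n k ω) (circleMap a r θ)‖ₑ ^ α)⁻¹ ≤
        ENNReal.ofReal (Real.exp (1 / (j + 1) * n)) := by
    intro j
    filter_upwards [hmω j, hRω, hne] with n h1 h2 h3
    rw [circleInvMoment, Set.indicator_of_mem (show (fun k => Z n k ω) ∈
      {z : Fin n → ℂ | (∃ k, ‖z k‖ ≤ R) ∧ ∀ k, ‖z k - a‖ ≠ r} from ⟨h2, h3⟩), one_mul] at h1
    exact h1.le
  refine ⟨?_, hne, ?_⟩
  · filter_upwards [hI 0, hne] with n h1 h2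
    exact weightedDerivative_ne_zero_of_lintegral hr hα h2
      (ne_top_of_le_ne_top ENNReal.ofReal_ne_top h1)
  · set A : ℕ → ℝ := fun n => Real.circleAverage (fun w =>
      Real.log ‖cauchySum (fun k => Z n k ω) (fun k => γ n k ω) w‖) a r
    have hupper : ∀ j : ℕ, ∀ᶠ n : ℕ in atTop, (n : ℝ)⁻¹ * A n ≤ 2 * (1 / (j + 1)) := by
      intro j
      filter_upwards [hgω j, hsω j, eventually_gt_atTop 0] with n h1 h2 h3
      have hn : (0 : ℝ) < n := by exact_mod_cast h3
      -- With `ε = 1 / (j + 1)` and `δ = exp(-ε n)`, this `T` makes `δ * T = exp(ε n)`, the bound on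
      -- the sum of weights.
      have := circleAverage_log_norm_cauchySum_le (T := Real.exp (2 * (1 / (j + 1) * n))) hr
        (Real.exp_pos (-(1 / (j + 1) * n))) h1 (Real.one_le_exp (by positivity))
        (h2.trans_eq (by rw [← Real.exp_add]; ring_nf))
      rw [Real.log_exp] at this
      rw [inv_mul_le_iff₀ hn]
      exact this.trans_eq (by ring)
    have hlower : ∀ j : ℕ, ∀ᶠ n : ℕ in atTop,
        -(1 / ((j : ℝ) + 1) + (n : ℝ)⁻¹) / α ≤ (n : ℝ)⁻¹ * A n := by
      intro j
      filter_upwards [hI j, eventually_gt_atTop 0] with n h1 h3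
      have hn : (0 : ℝ) < n := by exact_mod_cast h3
      have := le_circleAverage_log_norm_cauchySum hα (Real.one_le_exp (by positivity)) h1
      rw [Real.log_exp] at this
      rw [le_inv_mul_iff₀ hn]
      refine le_trans (le_of_eq ?_) this
      field_simp
    refine tendsto_order.2 ⟨fun b hb => ?_, fun b hb => ?_⟩
    · obtain ⟨j, hj⟩ := exists_nat_one_div_lt (show 0 < -b * α / 2 by nlinarith)
      have hinv : ∀ᶠ n : ℕ in atTop, (n : ℝ)⁻¹ < -b * α / 2 :=
        (tendsto_order.1 tendsto_inv_atTop_nhds_zero_nat).2 _ (by nlinarith)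
      filter_upwards [hlower j, hinv] with n h1 h2
      refine lt_of_lt_of_le ?_ h1
      rw [lt_div_iff₀ hα]
      linarith
    · obtain ⟨j, hj⟩ := exists_nat_one_div_lt (half_pos hb)
      filter_upwards [hupper j] with n h1
      linarith

end RandomWeights

/-! ### The theorem -/

theorem theorem1 {Ω : Type*} [MeasurableSpace Ω] (P : Measure Ω) [IsProbabilityMeasure P]
    (β : ℝ) (hβ : 0 < β)
    (Z : (n : ℕ) → Fin n → Ω → ℂ) (hZ : ∀ n k, Measurable (Z n k))
    (γ : (n : ℕ) → Fin n → Ω → ℝ) (hγ : ∀ n k, Measurable (γ n k))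
    (hγlaw : ∀ n k, P.map (γ n k) = gammaMeasure (β / 2) 1)
    (hγindep : ∀ n, iIndepFun (γ n) P)
    (hZγ : ∀ n, IndepFun (fun ω k => Z n k ω) (fun ω k => γ n k ω) P)
    (μ : FiniteMeasure ℂ)
    (hμ : ∀ᵐ ω ∂P, Tendsto (fun n : ℕ => pointMeasure (fun k => Z n k ω)) atTop (𝓝 μ)) :
    ∀ᵐ ω ∂P, Tendsto (fun n : ℕ => zeroMeasure (fun k => Z n k ω) (fun k => γ n k ω))
      atTop (𝓝 μ) := by
  have hb : 0 < β / 2 := half_pos hβ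
  have := isProbabilityMeasure_gammaMeasure hb one_pos
  obtain ⟨ω₀, hω₀⟩ := hμ.exists
  obtain ⟨R, hR⟩ := exists_eventually_norm_le_of_tendsto_pointMeasure
    (mass_eq_one_of_tendsto_pointMeasure hω₀)
  obtain ⟨α, hα, M, hMtop, hM⟩ := exists_lintegral_gammaMeasure_inv_enorm_sub_le hb
  obtain ⟨D, hDc, hD⟩ := TopologicalSpace.exists_countable_dense ℂ
  have hcirc := ae_ae_tendsto_circleAverage hZ hγ hγlaw hγindep hZγ
    (lintegral_gammaMeasure_enorm_ne_top hb) hα hMtop hM (hμ.mono fun ω hω => hR _ hω)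
  have hE : ∀ a : ℂ, ∃ E : Set ℝ, E.Countable ∧ Dense E ∧ ∀ r ∈ E, 0 < r → ∀ᵐ ω ∂P,
      (∀ᶠ n in atTop, weightedDerivative (fun k => Z n k ω) (fun k => γ n k ω) ≠ 0) ∧
      (∀ᶠ n in atTop, ∀ k, ‖Z n k ω - a‖ ≠ r) ∧
      Tendsto (fun n : ℕ => (n : ℝ)⁻¹ * Real.circleAverage (fun w =>
        Real.log ‖cauchySum (fun k => Z n k ω) (fun k => γ n k ω) w‖) a r) atTop (𝓝 0) := by
    intro a
    -- Countably many centres and radii, both dense, leave a single null set to discard.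
    obtain ⟨E, hEs, hEc, hEd⟩ := (Measure.dense_of_ae (hcirc a)).exists_countable_dense_subset
    exact ⟨E, hEc, hEd, fun r hr => hEs hr⟩
  choose E hEc hEd hEall using hE
  have hall : ∀ᵐ ω ∂P, ∀ a ∈ D, ∀ r ∈ E a, 0 < r →
      (∀ᶠ n in atTop, weightedDerivative (fun k => Z n k ω) (fun k => γ n k ω) ≠ 0) ∧
      (∀ᶠ n in atTop, ∀ k, ‖Z n k ω - a‖ ≠ r) ∧
      Tendsto (fun n : ℕ => (n : ℝ)⁻¹ * Real.circleAverage (fun w =>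
        Real.log ‖cauchySum (fun k => Z n k ω) (fun k => γ n k ω) w‖) a r) atTop (𝓝 0) := by
    refine (ae_ball_iff hDc).2 fun a _ => (ae_ball_iff (hEc a)).2 fun r hr => ?_
    by_cases h0 : 0 < r
    · exact (hEall a r hr h0).mono fun ω hω _ => hω
    · exact ae_of_all _ fun ω h => absurd h h0
  filter_upwards [hμ, hall] with ω hω hallω
  have hEex : ∀ a : ℂ, ∀ s t : ℝ, 0 < s → s < t → ∃ r ∈ E a ∩ Set.Ioi 0, s < r ∧ r < t := by
    intro a s t hs hst
    obtain ⟨r, hr, hrst⟩ := (hEd a).exists_between hst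
    exact ⟨r, ⟨hr, hs.trans hrst.1⟩, hrst⟩
  obtain ⟨a₀, ha₀⟩ := hD.nonempty
  obtain ⟨r₀, hr₀, -⟩ := hEex a₀ 1 2 one_pos one_lt_two
  exact tendsto_zeroMeasure_of_circleAverage hω hD (E := fun a => E a ∩ Set.Ioi 0)
    (fun a _ => hEex a) (hallω a₀ ha₀ r₀ hr₀.1 hr₀.2).1
    (fun a ha r hr => (hallω a ha r hr.1 hr.2).2.1)
    (fun a ha r hr => (hallω a ha r hr.1 hr.2).2.2)
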